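/- Let $F$ be an algebraically closed field of characteristic different from $2$, and let $R = F[[x,y]]/(x^2)$, a complete local ring of Krull dimension $1$ with residue field $F$. Let $Q$ be the quotient ring of $R$ (all nonzero divisors of $R$ inverted), let $\widetilde R$ be the integral closure of $R$ in $Q$, and let $I_\infty = xR$. An $R$-module $N$, finitely generated or not, is called Cohen–Macaulay (CM) if $\operatorname{Ext}^i_R(F,N)=0$ for all $0 \le i < \dim R$, i.e. if $\operatorname{Hom}_R(F,N)=0$. A morphism $f\colon A\to B$ of CM-modules is left almost split if it is not a split monomorphism and every morphism $A \to N$ to a CM-module $N$ which is not a split monomorphism factors through $f$. Dually, a morphism $g\colon B\to C$ of CM-modules is right almost split if it is not a split epimorphism and every morphism $N\to C$ from a CM-module $N$ which is not a split epimorphism factors through $g$. A sequence $0\to A\xrightarrow{f}B\xrightarrow{g}C\to 0$ is an almost split sequence (AR-sequence) in the category of all CM-modules over $R$ if it is an exact sequence of CM-modules, $f$ is left almost split and $g$ is right almost split. **Proposition 7.2.** Multiplication by $x$ in $Q$ defines a map $\widetilde R \to I_\infty$, and $$0 \longrightarrow \widetilde R \xrightarrow{\begin{pmatrix} y\\ x\end{pmatrix}}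 \widetilde R\oplus I_\infty \xrightarrow{(x,\,-y)} I_\infty \longrightarrow 0$$ is an almost split sequence in the category of all CM-modules over $R$. Moreover, its source $\widetilde R$ is not finitely generated as an $R$-module and is a pure-injective $R$-module, i.e. it is injective with respect to pure monomorphisms of $R$-modules. -/

import Mathlib

universe u

namespace AInfty

section General

variable {S : Type u} [CommRing S]

/-- A module `N`, finitely generated or not, over a commutative (noetherian) local ring `S` of
Krull dimension `d` with residue field `k` is (maximal) Cohen–Macaulay, `CM` for short, if
`Ext^i_S(k, N) = 0` for all `0 ≤ i < d`. -/
def IsCM (S : Type u) [CommRing S] [IsLocalRing S] (N : Type u) [AddCommGroup N] [Module S N] :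
    Prop :=
  ∀ i : ℕ, (i : WithBot ℕ∞) < ringKrullDim S →
    Subsingleton (CategoryTheory.Abelian.Ext
      (ModuleCat.of S (IsLocalRing.ResidueField S)) (ModuleCat.of S N) i)

/-- `f` is a split monomorphism of modules. -/
def IsSplitMono {A B : Type u} [AddCommGroup A] [Module S A] [AddCommGroup B] [Module S B]
    (f : A →ₗ[S] B) : Prop :=
  ∃ r : B →ₗ[S] A, r ∘ₗ f = LinearMap.id

/-- `g` is a split epimorphism of modules. -/
def IsSplitEpi {B C : Type u} [AddCommGroup B] [Module S B] [AddCommGroup C] [Module S C]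
    (g : B →ₗ[S] C) : Prop :=
  ∃ s : C →ₗ[S] B, g ∘ₗ s = LinearMap.id

/-- `f : A → B` is left almost split in the category of all CM-modules: it is not a split
monomorphism, and every morphism from `A` to a CM-module which is not a split monomorphism
factors through `f`. -/
def IsLeftAlmostSplit [IsLocalRing S] {A B : Type u} [AddCommGroup A] [Module S A]
    [AddCommGroup B] [Module S B] (f : A →ₗ[S] B) : Prop :=
  ¬ IsSplitMono f ∧
    ∀ (N : Type u) [AddCommGroup N] [Module S N], IsCM S N →
      ∀ h : A →ₗ[S] N, ¬ IsSplitMono h → ∃ u : B →ₗ[S] N, u ∘ₗ f = h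

/-- `g : B → C` is right almost split in the category of all CM-modules: it is not a split
epimorphism, and every morphism from a CM-module to `C` which is not a split epimorphism
factors through `g`. -/
def IsRightAlmostSplit [IsLocalRing S] {B C : Type u} [AddCommGroup B] [Module S B]
    [AddCommGroup C] [Module S C] (g : B →ₗ[S] C) : Prop :=
  ¬ IsSplitEpi g ∧
    ∀ (N : Type u) [AddCommGroup N] [Module S N], IsCM S N →
      ∀ h : N →ₗ[S] C, ¬ IsSplitEpi h → ∃ u : N →ₗ[S] B, g ∘ₗ u = h

/-- `0 → A → B → C → 0`, with maps `f` and `g`, is an almost split sequence (AR-sequence) in the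
category of all CM-modules over `S`. -/
structure IsAlmostSplitSequence [IsLocalRing S] {A B C : Type u} [AddCommGroup A] [Module S A]
    [AddCommGroup B] [Module S B] [AddCommGroup C] [Module S C]
    (f : A →ₗ[S] B) (g : B →ₗ[S] C) : Prop where
  cm_left : IsCM S A
  cm_middle : IsCM S B
  cm_right : IsCM S C
  injective : Function.Injective f
  exact : Function.Exact f g
  surjective : Function.Surjective g
  left_almost_split : IsLeftAlmostSplit f
  right_almost_split : IsRightAlmostSplit g

/-- `i : A → B` is a pure monomorphism: it is injective, and every finite system of linear
equations `∑ q, a p q • v q = m p` with constants `m p` in `A` which is solvable in `B` is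
solvable in `A`. -/
def IsPureMono {A B : Type u} [AddCommGroup A] [Module S A] [AddCommGroup B] [Module S B]
    (i : A →ₗ[S] B) : Prop :=
  Function.Injective i ∧
    ∀ (n k : ℕ) (a : Matrix (Fin n) (Fin k) S) (m : Fin n → A),
      (∃ w : Fin k → B, ∀ p, ∑ q, a p q • w q = i (m p)) →
        ∃ v : Fin k → A, ∀ p, ∑ q, a p q • v q = m p

/-- A module is pure injective if it is injective with respect to pure monomorphisms. -/
def IsPureInjective (S : Type u) [CommRing S] (M : Type u) [AddCommGroup M] [Module S M] : Prop :=
  ∀ (A B : Type u) [AddCommGroup A] [Module S A] [AddCommGroup B] [Module S B]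
    (i : A →ₗ[S] B), IsPureMono i →
      ∀ f : A →ₗ[S] M, ∃ g : B →ₗ[S] M, g ∘ₗ i = f

end General

section Singularity

variable (F : Type u) [Field F]

/-- The ring `R = F[[x, y]] / (x ^ 2)`; the variables `x`, `y` have the indices `0`, `1`. -/
abbrev R : Type u :=
  MvPowerSeries (Fin 2) F ⧸ Ideal.span {(MvPowerSeries.X 0 ^ 2 : MvPowerSeries (Fin 2) F)}

/-- The class of the variable `x` in `R`. -/
noncomputable def x : R F := Ideal.Quotient.mk _ (MvPowerSeries.X 0)

/-- The class of the variable `y` in `R`. -/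
noncomputable def y : R F := Ideal.Quotient.mk _ (MvPowerSeries.X 1)

instance : Nontrivial (R F) := by
  refine Ideal.Quotient.nontrivial_iff.mpr fun h => ?_
  rw [Ideal.span_singleton_eq_top] at h
  simpa using h.map (MvPowerSeries.constantCoeff (σ := Fin 2) (R := F))

instance : IsLocalRing (R F) :=
  IsLocalRing.of_surjective' (Ideal.Quotient.mk _) Ideal.Quotient.mk_surjective

/-- The quotient ring `Q` of `R`: all nonzero divisors of `R` are inverted. -/
abbrev Q : Type u := FractionRing (R F)

/-- The integral closure `R̃` of `R` in its quotient ring `Q`, a subalgebra of `Q` and so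
an `R`-module. -/
noncomputable abbrev Rtilde : Subalgebra (R F) (Q F) := integralClosure (R F) (Q F)

/-- The ideal `I_∞ = xR` of `R`. -/
noncomputable abbrev Iinf : Ideal (R F) := Ideal.span {x F}

end Singularity

end AInfty

/-!
Put `A = F⟦y⟧` with fraction field `K`. Then `R = A ⊕ xA` is the ring of dual numbers over `A`, its
quotient ring is `Q = K ⊕ xK`, and the integral closure of `R` in `Q` is `A ⊕ xK`, since `xK` is
nilpotent and `A` is integrally closed. The integral closure is not finitely generated because `K`
is not finite over `A`. As `x ^ 2 = 0`, a module is Cohen–Macaulay exactly if it is `y`-torsion-free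
(`isCM_iff`).

An `R`-linear map from `N` to `A ⊕ xK` is a pair of `A`-linear maps `α : N → A` and `β : N → K` with
`β (x • n) = α n` (`Coordinates.hom`). Given an `α` that kills the annihilator of `x`, a suitable
`β` exists because `K` is an injective `A`-module (`exists_extension_fractionRing`). To construct `α`,
one extends a map along some `i : P → N`. This is possible as soon as the map preserves the
divisibilities by powers of `y` that hold in `N` (`exists_extension_powerSeries`): `A` is
the dual of the `F`-vector space `K / A`, so only a linear functional has to be extended. The three
substantial claims all follow from these two extension results.

* Left almost split: a map `h` from `A ⊕ xK` to `N` is determined by `h 1`. If `x • h 1` lies in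
  `y • x • N`, then `h` factors (`Coordinates.exists_factor_left`). Otherwise there is an `α` with
  `α (h 1) = 1`, which gives a retraction of `h` (`Coordinates.isSplitMono_of_not_dvd`).
* Right almost split: a map `h : N → xR ≅ A` that maps an element killed by `x` to a generator
  splits (`isSplitEpi_of_not_dvd`). Otherwise `-h / y` is defined on the annihilator of `x`, and an
  extension `σ` of it to `N` makes `h + yσ` the `α` of a factorization
  (`Coordinates.exists_factor_right`).
* Pure injectivity: `α` and `β` both extend along a pure monomorphism
  (`Coordinates.isPureInjective`).
-/

namespace AInfty

open PowerSeries

/-! ### Extension of maps into power series rings and their fraction fields -/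

section Extension

/-- A linear functional on the source of a linear map of vector spaces factors through the map as
soon as it vanishes on the kernel. -/
lemma exists_functional_comp_eq {F V W : Type*} [Field F] [AddCommGroup V] [Module F V]
    [AddCommGroup W] [Module F W] (T : V →ₗ[F] W) (φ : V →ₗ[F] F)
    (h : ∀ v, T v = 0 → φ v = 0) : ∃ ψ : W →ₗ[F] F, ∀ v, ψ (T v) = φ v := by
  have hφ : φ ∈ LinearMap.range T.dualMap := by
    rw [LinearMap.range_dualMap_eq_dualAnnihilator_ker]
    exact (Submodule.mem_dualAnnihilator φ).mpr fun v hv => h v hv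
  obtain ⟨ψ, hψ⟩ := hφ
  exact ⟨ψ, fun v => LinearMap.congr_fun hψ v⟩

/-- An `F`-linear map into `F⟦X⟧` that commutes with `X` is `F⟦X⟧`-linear: the `X`-adic topology
on the target is Hausdorff, so no continuity is needed. -/
lemma powerSeries_map_smul {F M : Type*} [Field F] [AddCommGroup M] [Module F M] [Module F⟦X⟧ M]
    [IsScalarTower F F⟦X⟧ M] (ν : M →ₗ[F] F⟦X⟧)
    (hν : ∀ m, ν ((X : F⟦X⟧) • m) = X * ν m) (a : F⟦X⟧) (m : M) : ν (a • m) = a * ν m := by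
  ext n
  induction n generalizing a m with
  | zero =>
    conv_lhs => rw [eq_X_mul_shift_add_const a]
    rw [add_smul, mul_smul, map_add, hν, ← algebraMap_eq, algebraMap_smul, map_smul ν]
    simp
  | succ n ih =>
    obtain ⟨b, c, rfl⟩ : ∃ (b : F⟦X⟧) (c : F), a = X * b + C c :=
      ⟨_, _, eq_X_mul_shift_add_const a⟩
    rw [add_smul, mul_smul, map_add, hν, add_mul, map_add, map_add, mul_assoc,
      coeff_succ_X_mul, coeff_succ_X_mul, ih, ← algebraMap_eq, algebraMap_smul, map_smul ν,
      Algebra.smul_def]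

/-- Extension of maps into `F⟦X⟧`: a map `μ : P → F⟦X⟧` factors through `i : P → M` as soon as
every divisibility by a power of `X` that holds for `i p` in `M` holds for `μ p`. In particular
`F⟦X⟧` is pure injective. A linear map `ν : M → F⟦X⟧` is a sequence of functionals
`cₙ = coeff n ∘ ν` with `cₙ₊₁ (X • m) = cₙ m` and `c₀ (X • m) = 0`, that is, one functional on
`⨁ₙ M` with prescribed values on a subspace. -/
theorem exists_extension_powerSeries {F : Type*} [Field F] {P M : Type*} [AddCommGroup P]
    [Module F⟦X⟧ P] [AddCommGroup M] [Module F⟦X⟧ M] (i : P →ₗ[F⟦X⟧] M) (μ : P →ₗ[F⟦X⟧] F⟦X⟧)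
    (h : ∀ (n : ℕ) (p : P) (m : M), (X : F⟦X⟧) ^ n • m = i p → X ^ n ∣ μ p) :
    ∃ ν : M →ₗ[F⟦X⟧] F⟦X⟧, ∀ p, ν (i p) = μ p := by
  classical
  let _ : Module F M := Module.compHom M (C : F →+* F⟦X⟧)
  let _ : Module F P := Module.compHom P (C : F →+* F⟦X⟧)
  have : IsScalarTower F F⟦X⟧ M := IsScalarTower.of_algebraMap_smul fun _ _ => rfl
  have : IsScalarTower F F⟦X⟧ P := IsScalarTower.of_algebraMap_smul fun _ _ => rfl
  let iF : P →ₗ[F] M := i.restrictScalars F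
  let μF : P →ₗ[F] F⟦X⟧ := μ.restrictScalars F
  let Y : M →ₗ[F] M := (Algebra.lsmul F F M (X : F⟦X⟧)).restrictScalars F
  -- The relations to impose: `single (n + 1) (X • m) - single n m` and `single 0 (X • m)`.
  let T₁ : (ℕ →₀ P) →ₗ[F] (ℕ →₀ M) := Finsupp.mapRange.linearMap iF
  let T₂ : (ℕ →₀ M) →ₗ[F] (ℕ →₀ M) :=
    Finsupp.lmapDomain M F Nat.succ ∘ₗ Finsupp.mapRange.linearMap Y - LinearMap.id
  let T₃ : M →ₗ[F] (ℕ →₀ M) := Finsupp.lsingle 0 ∘ₗ Y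
  let T : ((ℕ →₀ P) × (ℕ →₀ M) × M) →ₗ[F] (ℕ →₀ M) := T₁.coprod (T₂.coprod T₃)
  let φ₀ : (ℕ →₀ P) →ₗ[F] F := Finsupp.lsum F fun n => (coeff n) ∘ₗ μF
  let φ : ((ℕ →₀ P) × (ℕ →₀ M) × M) →ₗ[F] F := φ₀ ∘ₗ LinearMap.fst _ _ _
  have hker : ∀ v, T v = 0 → φ v = 0 := by
    rintro ⟨p, w, m⟩ hT
    have hT' : T₁ p + (T₂ w + T₃ m) = 0 := hT
    have h0 : i (p 0) = w 0 - (X : F⟦X⟧) • m := by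
      have := DFunLike.congr_fun hT' 0
      have hz : (Finsupp.mapDomain Nat.succ (Finsupp.mapRange.linearMap Y w)) 0 = 0 :=
        Finsupp.mapDomain_of_notMem_range _ _ (by simp)
      simp only [T₁, T₂, T₃, iF, Y, Finsupp.coe_add, Pi.add_apply, LinearMap.sub_apply,
        LinearMap.comp_apply, Finsupp.coe_sub, Pi.sub_apply, Finsupp.lmapDomain_apply,
        LinearMap.id_apply, Finsupp.lsingle_apply, Finsupp.single_eq_same] at this
      rw [hz] at this
      simp at this
      rw [eq_neg_of_add_eq_zero_left this]
      abel
    have hs : ∀ n, i (p (n + 1)) = w (n + 1) - (X : F⟦X⟧) • w n := by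
      intro n
      have := DFunLike.congr_fun hT' (n + 1)
      have hz : (Finsupp.mapDomain Nat.succ (Finsupp.mapRange.linearMap Y w)) (n + 1) =
          Finsupp.mapRange.linearMap Y w n :=
        Finsupp.mapDomain_apply Nat.succ_injective _ _
      simp only [T₁, T₂, T₃, iF, Y, Finsupp.coe_add, Pi.add_apply, LinearMap.sub_apply,
        LinearMap.comp_apply, Finsupp.coe_sub, Pi.sub_apply, Finsupp.lmapDomain_apply,
        LinearMap.id_apply, Finsupp.lsingle_apply] at this
      rw [hz] at this
      simp at this
      rw [eq_neg_of_add_eq_zero_left this, neg_sub]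
      rfl
    have hsum : ∀ n, i (∑ k ∈ Finset.range (n + 1), (X : F⟦X⟧) ^ (n - k) • p k) =
        w n - (X : F⟦X⟧) ^ (n + 1) • m := by
      intro n
      induction n with
      | zero => simpa using h0
      | succ n ih =>
        have : ∑ k ∈ Finset.range (n + 1), (X : F⟦X⟧) ^ (n + 1 - k) • p k =
            (X : F⟦X⟧) • ∑ k ∈ Finset.range (n + 1), (X : F⟦X⟧) ^ (n - k) • p k := by
          rw [Finset.smul_sum]
          refine Finset.sum_congr rfl fun k hk => ?_
          rw [smul_smul, ← pow_succ', Nat.sub_add_comm (by simpa [Nat.lt_succ_iff] using hk)]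
        rw [Finset.sum_range_succ, map_add, this, map_smul, ih, Nat.sub_self, pow_zero, one_smul,
          hs, smul_sub, smul_smul, ← pow_succ']
        abel
    obtain ⟨n, hn⟩ : ∃ n, ∀ k, n ≤ k → w k = 0 ∧ p k = 0 := by
      refine ⟨(w.support ∪ p.support).sup id + 1, fun k hk => ?_⟩
      have : k ∉ w.support ∪ p.support := fun hmem => by
        have := Finset.le_sup (f := id) hmem
        simp only [id] at this
        omega
      simpa [not_or] using this
    -- Beyond the supports of `w` and `p` the sum in `hsum` is a multiple of `X ^ (n + 1)`, so that
    -- the coefficient of `X ^ n`, which is the value of `φ`, vanishes.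
    have hdvd := h (n + 1) (∑ k ∈ Finset.range (n + 1), (X : F⟦X⟧) ^ (n - k) • p k) (-m)
      (by rw [hsum, (hn n le_rfl).1, smul_neg, zero_sub])
    have hc := X_pow_dvd_iff.mp hdvd n (Nat.lt_succ_self n)
    have hφ : φ (p, w, m) = ∑ k ∈ Finset.range (n + 1), coeff k (μ (p k)) := by
      change φ₀ p = _
      rw [Finsupp.lsum_apply]
      refine Finsupp.sum_of_support_subset _ (fun k hk => ?_) _ (by simp)
      by_contra hlt
      rw [Finset.mem_range, not_lt] at hlt
      exact Finsupp.mem_support_iff.mp hk (hn k (by omega)).2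
    rw [hφ, ← hc, map_sum, map_sum]
    refine Finset.sum_congr rfl fun k hk => ?_
    have hk' : k ≤ n := by simpa [Nat.lt_succ_iff] using hk
    rw [map_smul, smul_eq_mul, coeff_X_pow_mul', if_pos (Nat.sub_le n k), Nat.sub_sub_self hk']
  obtain ⟨ψ, hψ⟩ := exists_functional_comp_eq T φ hker
  let ν₀ : M →ₗ[F] F⟦X⟧ :=
    { toFun := fun m => PowerSeries.mk fun n => ψ (Finsupp.single n m)
      map_add' := fun a b => by ext; simp
      map_smul' := fun c a => by ext; simp [← Finsupp.smul_single] }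
  have hX : ∀ m, ν₀ ((X : F⟦X⟧) • m) = X * ν₀ m := by
    intro m
    ext n
    cases n with
    | zero =>
      have := hψ (0, 0, m)
      simpa [T, T₃, φ, ν₀, Y] using this
    | succ n =>
      have := hψ (0, Finsupp.single n m, 0)
      rw [coeff_succ_X_mul]
      simpa [T, T₂, φ, ν₀, Y, sub_eq_zero] using this
  refine ⟨{ toFun := ν₀, map_add' := map_add ν₀,
            map_smul' := fun a m => powerSeries_map_smul ν₀ hX a m }, fun p => ?_⟩
  ext n
  have := hψ (Finsupp.single n p, 0, 0)
  simpa [T, T₁, φ, φ₀, ν₀, iF, μF] using this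

/-- The fraction field of a principal ideal domain is an injective module, since it is divisible:
a map into it factors through `i : P → M` as soon as it vanishes on the kernel of `i`. -/
theorem exists_extension_fractionRing {A : Type*} [CommRing A] [IsDomain A]
    [IsPrincipalIdealRing A] {K : Type*} [Field K] [Algebra A K] [IsFractionRing A K]
    {P M : Type*} [AddCommGroup P] [Module A P] [AddCommGroup M] [Module A M]
    (i : P →ₗ[A] M) (μ : P →ₗ[A] K) (h : ∀ p, i p = 0 → μ p = 0) :
    ∃ ν : M →ₗ[A] K, ∀ p, ν (i p) = μ p := by
  have hB : Module.Baer A K := by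
    intro I g
    obtain ⟨a, rfl⟩ := (IsPrincipalIdealRing.principal I).principal
    rcases eq_or_ne a 0 with rfl | ha
    · exact ⟨0, fun b hb => by
        have : (⟨b, hb⟩ : Submodule.span A {(0 : A)}) = 0 := by
          ext; simpa [Ideal.mem_span_singleton] using hb
        rw [this]; simp⟩
    · have ha' : algebraMap A K a ≠ 0 := by simpa using ha
      let g₀ := g ⟨a, Submodule.mem_span_singleton_self a⟩
      refine ⟨LinearMap.toSpanSingleton A _ ((algebraMap A K a)⁻¹ * g₀),
        fun b hb => ?_⟩
      obtain ⟨c, rfl⟩ := Submodule.mem_span_singleton.mp hb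
      have : (⟨c • a, hb⟩ : Submodule.span A {a}) =
          c • ⟨a, Submodule.mem_span_singleton_self a⟩ := rfl
      rw [this, map_smul, map_smul g, LinearMap.toSpanSingleton_apply, Algebra.smul_def a,
        mul_inv_cancel_left₀ ha']
  have hi : Function.Injective ((LinearMap.ker i).liftQ i le_rfl) :=
    LinearMap.ker_eq_bot.mp (Submodule.ker_liftQ_eq_bot _ _ _ le_rfl)
  obtain ⟨ν, hν⟩ := hB.extension_property _ hi ((LinearMap.ker i).liftQ μ fun p hp => h p hp)
  exact ⟨ν, fun p => LinearMap.congr_fun hν (Submodule.Quotient.mk p)⟩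

end Extension

/-! ### The ring `R` as a ring of dual numbers -/

section Ring

variable (F : Type u) [Field F]

/-- The ring homomorphism `S⟦X⟧ → S[ε]` which sends `X` to `ε`. -/
noncomputable def powerSeriesToDual (S : Type*) [CommRing S] : S⟦X⟧ →+* DualNumber S where
  toFun p := TrivSqZeroExt.inl (coeff 0 p) + TrivSqZeroExt.inr (coeff 1 p)
  map_one' := by ext <;> simp [coeff_one]
  map_mul' p q := by
    ext
    · simp
    · simp [coeff_mul, Finset.Nat.antidiagonal_succ, mul_comm]
  map_zero' := by ext <;> simp
  map_add' p q := by ext <;> simp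

/-- Power series in one variable indexed by `Fin 1` are the elements of `F⟦X⟧`. -/
noncomputable def finOneEquiv : MvPowerSeries (Fin 1) F ≃ₐ[F] F⟦X⟧ :=
  MvPowerSeries.renameEquiv F (Equiv.ofUnique (Fin 1) Unit)

/-- The homomorphism `F⟦x, y⟧ → F⟦y⟧[ε]` which sends `x` to `ε`. -/
noncomputable def toDual : MvPowerSeries (Fin 2) F →+* DualNumber F⟦X⟧ :=
  (powerSeriesToDual F⟦X⟧).comp
    ((PowerSeries.map (finOneEquiv F : MvPowerSeries (Fin 1) F →+* F⟦X⟧)).comp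
      (MvPowerSeries.finSuccEquiv F 1 : MvPowerSeries (Fin 2) F →+* _))

lemma toDual_apply (f : MvPowerSeries (Fin 2) F) :
    toDual F f = TrivSqZeroExt.inl (finOneEquiv F (coeff 0 (MvPowerSeries.finSuccEquiv F 1 f))) +
      TrivSqZeroExt.inr (finOneEquiv F (coeff 1 (MvPowerSeries.finSuccEquiv F 1 f))) := rfl

lemma toDual_X_zero : toDual F (MvPowerSeries.X 0) = DualNumber.eps := by
  rw [toDual_apply, MvPowerSeries.finSuccEquiv_X_zero]
  ext <;> simp [coeff_X]

lemma toDual_X_one : toDual F (MvPowerSeries.X 1) = TrivSqZeroExt.inl X := by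
  have h : MvPowerSeries.finSuccEquiv F 1 (MvPowerSeries.X 1) = C (MvPowerSeries.X 0) :=
    MvPowerSeries.finSuccEquiv_X_succ (R := F) (n := 1) 0
  have h' : finOneEquiv F (MvPowerSeries.X 0) = X := MvPowerSeries.rename_X ..
  rw [toDual_apply, h]
  ext <;> simp [coeff_C, h']

lemma toDual_surjective : Function.Surjective (toDual F) := by
  intro z
  refine ⟨(MvPowerSeries.finSuccEquiv F 1).symm
    (C ((finOneEquiv F).symm z.fst) + X * C ((finOneEquiv F).symm z.snd)), ?_⟩
  rw [toDual_apply, AlgEquiv.apply_symm_apply]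
  ext <;> simp

lemma ker_toDual : RingHom.ker (toDual F) = Ideal.span {MvPowerSeries.X 0 ^ 2} := by
  refine le_antisymm (fun f hf => ?_) ?_
  · rw [RingHom.mem_ker, toDual_apply] at hf
    have h0 : coeff 0 (MvPowerSeries.finSuccEquiv F 1 f) = 0 := by
      simpa using congrArg TrivSqZeroExt.fst hf
    have h1 : coeff 1 (MvPowerSeries.finSuccEquiv F 1 f) = 0 := by
      simpa using congrArg TrivSqZeroExt.snd hf
    have h2 : (X : (MvPowerSeries (Fin 1) F)⟦X⟧) ^ 2 ∣ MvPowerSeries.finSuccEquiv F 1 f := by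
      refine X_pow_dvd_iff.mpr fun m hm => ?_
      interval_cases m <;> assumption
    rw [Ideal.mem_span_singleton]
    have := map_dvd (MvPowerSeries.finSuccEquiv F 1).symm h2
    rwa [map_pow, ← MvPowerSeries.finSuccEquiv_X_zero, AlgEquiv.symm_apply_apply,
      AlgEquiv.symm_apply_apply] at this
  · rw [Ideal.span_singleton_le_iff_mem, RingHom.mem_ker, map_pow, toDual_X_zero, sq,
      DualNumber.eps_mul_eps]

/-- The ring `R` is the ring of dual numbers over `F⟦y⟧`. -/
noncomputable def dualEquiv : R F ≃+* DualNumber F⟦X⟧ :=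
  (Ideal.quotEquivOfEq (ker_toDual F).symm).trans
    (RingHom.quotientKerEquivOfSurjective (toDual_surjective F))

@[simp]
lemma dualEquiv_x : dualEquiv F (x F) = DualNumber.eps := toDual_X_zero F

@[simp]
lemma dualEquiv_y : dualEquiv F (y F) = TrivSqZeroExt.inl X := toDual_X_one F

/-- `R` as an algebra over `F⟦X⟧`, where the variable `X` acts as `y`. -/
noncomputable instance : Algebra F⟦X⟧ (R F) :=
  ((dualEquiv F).symm.toRingHom.comp (TrivSqZeroExt.inlHom F⟦X⟧ F⟦X⟧)).toAlgebra

lemma algebraMap_eq_symm (a : F⟦X⟧) :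
    algebraMap F⟦X⟧ (R F) a = (dualEquiv F).symm (TrivSqZeroExt.inl a) := rfl

@[simp]
lemma dualEquiv_algebraMap (a : F⟦X⟧) :
    dualEquiv F (algebraMap F⟦X⟧ (R F) a) = TrivSqZeroExt.inl a := by
  rw [algebraMap_eq_symm, RingEquiv.apply_symm_apply]

@[simp]
lemma algebraMap_X : algebraMap F⟦X⟧ (R F) X = y F := by
  rw [algebraMap_eq_symm, RingEquiv.symm_apply_eq, dualEquiv_y]

lemma x_mul_x : x F * x F = 0 := by
  apply (dualEquiv F).injective
  simp

variable {F}

lemma eq_algebraMap_add (r : R F) :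
    r = algebraMap F⟦X⟧ (R F) (dualEquiv F r).fst +
      x F * algebraMap F⟦X⟧ (R F) (dualEquiv F r).snd := by
  apply (dualEquiv F).injective
  ext <;> simp

lemma isUnit_iff_isUnit_fst (r : R F) : IsUnit r ↔ IsUnit (dualEquiv F r).fst := by
  rw [← TrivSqZeroExt.isUnit_iff_isUnit_fst, MulEquiv.isUnit_map]

lemma not_isUnit_y : ¬ IsUnit (y F) := by
  rw [isUnit_iff_isUnit_fst, dualEquiv_y]
  exact X_prime.not_isUnit

variable (F) in
/-- `R` has Krull dimension one: modulo its nilpotent ideal `xR` it is the discrete valuation ring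
`F⟦y⟧`. -/
lemma ringKrullDim_R : ringKrullDim (R F) = 1 := by
  let π : R F →+* F⟦X⟧ :=
    (TrivSqZeroExt.fstHom F⟦X⟧ F⟦X⟧ F⟦X⟧ : DualNumber F⟦X⟧ →+* F⟦X⟧).comp
      (dualEquiv F : R F →+* DualNumber F⟦X⟧)
  have hπ : Function.Surjective π := fun a => ⟨algebraMap F⟦X⟧ (R F) a, by simp [π]⟩
  have hker : PrimeSpectrum.zeroLocus (RingHom.ker π : Set (R F)) = Set.univ := by
    rw [PrimeSpectrum.zeroLocus_eq_univ_iff]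
    intro r hr
    refine ⟨2, ?_⟩
    apply (dualEquiv F).injective
    have : (dualEquiv F r).fst = 0 := hr
    rw [map_pow, sq]
    ext <;> simp [this]
  have hdim : ringKrullDim (R F ⧸ RingHom.ker π) = ringKrullDim F⟦X⟧ :=
    ringKrullDim_eq_of_ringEquiv (RingHom.quotientKerEquivOfSurjective hπ)
  rw [ringKrullDim_quotient, hker, IsDiscreteValuationRing.ringKrullDim_eq_one] at hdim
  rw [← hdim]
  exact (Order.krullDim_eq_of_orderIso OrderIso.Set.univ).symm

end Ring

/-! ### Cohen–Macaulay modules -/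

section CM

variable {F : Type u} [Field F]

lemma x_smul_x_smul {N : Type*} [AddCommGroup N] [Module (R F) N] (n : N) :
    x F • x F • n = 0 := by
  rw [smul_smul, x_mul_x]
  exact zero_smul (R F) n

/-- A Cohen–Macaulay module over `R` is the same as a `y`-torsion-free module: if `y • n = 0` then
both `x` and `y` kill `x • n`, as well as `n` if `x • n = 0`. -/
lemma isCM_iff {N : Type u} [AddCommGroup N] [Module (R F) N] :
    IsCM (R F) N ↔ ∀ n : N, y F • n = 0 → n = 0 := by
  have hdim : ∀ i : ℕ, (i : WithBot ℕ∞) < ringKrullDim (R F) ↔ i = 0 := by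
    intro i
    rw [ringKrullDim_R]
    norm_cast
    exact Nat.lt_one_iff
  have hHom : IsCM (R F) N ↔ Subsingleton (IsLocalRing.ResidueField (R F) →ₗ[R F] N) := by
    unfold IsCM
    simp only [hdim, forall_eq]
    exact (CategoryTheory.Abelian.Ext.homEquiv₀.trans ModuleCat.homEquiv).subsingleton_congr
  rw [hHom]
  constructor
  · intro hsub
    have hsoc : ∀ n : N, x F • n = 0 → y F • n = 0 → n = 0 := by
      intro n hx hy
      have hm : IsLocalRing.maximalIdeal (R F) ≤
          LinearMap.ker (LinearMap.toSpanSingleton (R F) N n) := by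
        intro r hr
        rw [IsLocalRing.mem_maximalIdeal, mem_nonunits_iff, isUnit_iff_isUnit_fst] at hr
        obtain ⟨a, ha⟩ : X ∣ (dualEquiv F r).fst := by
          rw [X_dvd_iff]
          by_contra h0
          exact hr (isUnit_iff_constantCoeff.mpr (isUnit_iff_ne_zero.mpr h0))
        rw [LinearMap.mem_ker, LinearMap.toSpanSingleton_apply, eq_algebraMap_add r, ha, map_mul,
          algebraMap_X, add_smul, mul_comm (y F), mul_comm (x F), mul_smul, mul_smul, hx, hy,
          smul_zero, smul_zero, add_zero]
      let f : IsLocalRing.ResidueField (R F) →ₗ[R F] N :=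
        Submodule.liftQ (IsLocalRing.maximalIdeal (R F))
          (LinearMap.toSpanSingleton (R F) N n) hm
      have h1 : f (IsLocalRing.residue (R F) 1) = n := one_smul (R F) n
      rw [← h1, Subsingleton.elim f 0, LinearMap.zero_apply]
    intro n hn
    have hxn : x F • n = 0 := hsoc _ (x_smul_x_smul n) (by rw [smul_comm, hn, smul_zero])
    exact hsoc n hxn hn
  · refine fun h => subsingleton_of_forall_eq 0 fun f => LinearMap.ext fun k => h _ ?_
    have : y F • k = 0 := by
      rw [Algebra.smul_def, IsLocalRing.ResidueField.algebraMap_eq,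
        IsLocalRing.residue_eq_zero_iff _ |>.mpr not_isUnit_y, zero_mul]
    rw [← map_smul, this, map_zero]

end CM

/-! ### Modules over `R` as modules over `F⟦X⟧` -/

section Module

variable {F : Type u} [Field F]

variable {N : Type*} [AddCommGroup N] [Module (R F) N] [Module F⟦X⟧ N]
  [IsScalarTower F⟦X⟧ (R F) N]
variable {P : Type*} [AddCommGroup P] [Module (R F) P] [Module F⟦X⟧ P]
  [IsScalarTower F⟦X⟧ (R F) P]

lemma X_smul_eq (n : N) : (X : F⟦X⟧) • n = y F • n := by
  rw [← algebraMap_smul (R F) (X : F⟦X⟧) n, algebraMap_X]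

lemma X_pow_smul_eq_zero (h : ∀ n : N, y F • n = 0 → n = 0) (k : ℕ) (n : N)
    (hn : (X : F⟦X⟧) ^ k • n = 0) : n = 0 := by
  induction k with
  | zero => simpa using hn
  | succ k ih =>
    rw [pow_succ', mul_smul, X_smul_eq] at hn
    exact ih (h _ hn)

/-- Over a `y`-torsion-free module a nonzero power series acts injectively. -/
lemma powerSeries_smul_eq_zero (h : ∀ n : N, y F • n = 0 → n = 0) {a : F⟦X⟧} (ha : a ≠ 0) (n : N)
    (hn : a • n = 0) : n = 0 := by
  obtain ⟨k, u, rfl⟩ := IsDiscreteValuationRing.eq_unit_mul_pow_irreducible ha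
    (X_prime (R := F)).irreducible
  rw [mul_smul, ← Units.smul_def, smul_eq_zero_iff_eq] at hn
  exact X_pow_smul_eq_zero h k n hn

/-- Multiplication by `x` as an `F⟦X⟧`-linear endomorphism. -/
noncomputable def xMul (F : Type u) [Field F] (N : Type*) [AddCommGroup N] [Module (R F) N]
    [Module F⟦X⟧ N] [IsScalarTower F⟦X⟧ (R F) N] : N →ₗ[F⟦X⟧] N :=
  (LinearMap.lsmul (R F) N (x F)).restrictScalars F⟦X⟧

@[simp]
lemma xMul_apply (n : N) : xMul F N n = x F • n := rfl

/-- An `F⟦X⟧`-linear map that commutes with `x` is `R`-linear. -/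
noncomputable def linearOfCommute (f : N →ₗ[F⟦X⟧] P) (hf : ∀ n, f (x F • n) = x F • f n) :
    N →ₗ[R F] P where
  toFun := f
  map_add' := map_add f
  map_smul' r n := by
    rw [RingHom.id_apply, eq_algebraMap_add r, add_smul, add_smul, mul_smul, mul_smul, map_add, hf,
      algebraMap_smul, algebraMap_smul, algebraMap_smul, algebraMap_smul, map_smul, map_smul]

end Module

/-! ### The integral closure and the ideal `xR` in coordinates -/

section Coordinates

/-- The map on dual numbers induced by a ring homomorphism. -/
def dualMap {S T : Type*} [CommRing S] [CommRing T] (f : S →+* T) :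
    DualNumber S →+* DualNumber T where
  toFun z := TrivSqZeroExt.inl (f z.fst) + TrivSqZeroExt.inr (f z.snd)
  map_one' := by ext <;> simp
  map_mul' z w := by ext <;> simp [mul_comm]
  map_zero' := by ext <;> simp
  map_add' z w := by ext <;> simp

@[simp]
lemma fst_dualMap {S T : Type*} [CommRing S] [CommRing T] (f : S →+* T) (z : DualNumber S) :
    (dualMap f z).fst = f z.fst := by
  simp [dualMap]

@[simp]
lemma snd_dualMap {S T : Type*} [CommRing S] [CommRing T] (f : S →+* T) (z : DualNumber S) :
    (dualMap f z).snd = f z.snd := by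
  simp [dualMap]

variable (F : Type u) [Field F]

variable (K : Type*) [Field K] [Algebra F⟦X⟧ K]

/-- The inclusion of `R = F⟦y⟧[ε]` into the dual numbers over a field `K` of fractions of
`F⟦y⟧`. -/
noncomputable def toDualFrac : R F →+* DualNumber K :=
  (dualMap (algebraMap F⟦X⟧ K)).comp (dualEquiv F : R F →+* DualNumber F⟦X⟧)

noncomputable instance : Algebra (R F) (DualNumber K) :=
  (toDualFrac F K).toAlgebra

variable {F} {K}

@[simp]
lemma fst_algebraMap (r : R F) :
    (algebraMap (R F) (DualNumber K) r).fst =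
      algebraMap F⟦X⟧ K (dualEquiv F r).fst :=
  fst_dualMap _ _

@[simp]
lemma snd_algebraMap (r : R F) :
    (algebraMap (R F) (DualNumber K) r).snd =
      algebraMap F⟦X⟧ K (dualEquiv F r).snd :=
  snd_dualMap _ _

variable [IsFractionRing F⟦X⟧ K]

variable (K) in
lemma algebraMap_dual_injective :
    Function.Injective (algebraMap (R F) (DualNumber K)) := by
  intro r s h
  apply (dualEquiv F).injective
  refine TrivSqZeroExt.ext ?_ ?_
  · apply IsFractionRing.injective F⟦X⟧ K
    simpa using congrArg TrivSqZeroExt.fst h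
  · apply IsFractionRing.injective F⟦X⟧ K
    simpa using congrArg TrivSqZeroExt.snd h

lemma fst_ne_zero_of_mem_nonZeroDivisors {r : R F} (hr : r ∈ nonZeroDivisors (R F)) :
    (dualEquiv F r).fst ≠ 0 := by
  intro h
  have hx : x F * r = 0 := by
    apply (dualEquiv F).injective
    ext <;> simp [h]
  have := (mul_right_mem_nonZeroDivisors_eq_zero_iff hr).mp hx
  simpa using congrArg (fun z => (dualEquiv F z).snd) this

variable (F K) in
/-- The total quotient ring of `R = F⟦y⟧[ε]` is the ring of dual numbers over the fraction field of
`F⟦y⟧`. -/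
instance : IsFractionRing (R F) (DualNumber K) where
  map_units r := by
    rw [TrivSqZeroExt.isUnit_iff_isUnit_fst, fst_algebraMap, isUnit_iff_ne_zero]
    simpa using fst_ne_zero_of_mem_nonZeroDivisors r.2
  surj z := by
    classical
    obtain ⟨c, hc⟩ := IsLocalization.exist_integer_multiples_of_finset (nonZeroDivisors F⟦X⟧)
      ({z.fst, z.snd} : Finset K)
    obtain ⟨a, ha⟩ := hc z.fst (by simp)
    obtain ⟨b, hb⟩ := hc z.snd (by simp)
    have hc0 : (c : F⟦X⟧) ≠ 0 := nonZeroDivisors.ne_zero c.2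
    have hmem : algebraMap F⟦X⟧ (R F) c ∈ nonZeroDivisors (R F) := by
      rw [mem_nonZeroDivisors_iff_right]
      intro s hs
      have hs' := congrArg (dualEquiv F) hs
      apply (dualEquiv F).injective
      refine TrivSqZeroExt.ext ?_ ?_
      · simpa [hc0] using congrArg TrivSqZeroExt.fst hs'
      · simpa [hc0] using congrArg TrivSqZeroExt.snd hs'
    refine ⟨((dualEquiv F).symm (TrivSqZeroExt.inl a + TrivSqZeroExt.inr b), ⟨_, hmem⟩), ?_⟩
    rw [Algebra.smul_def] at ha hb
    ext
    · simp [ha, mul_comm]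
    · simp [hb, mul_comm]
  exists_of_eq h := ⟨1, by rw [algebraMap_dual_injective K h]⟩

variable (F K) in
/-- The identification of the quotient ring `Q` with dual numbers. -/
noncomputable def fractionEquiv : Q F ≃ₐ[R F] DualNumber K :=
  IsLocalization.algEquiv (nonZeroDivisors (R F)) _ _

variable (K) in
lemma isIntegral_iff (q : Q F) :
    IsIntegral (R F) q ↔
      ∃ a : F⟦X⟧, algebraMap F⟦X⟧ K a = (fractionEquiv F K q).fst := by
  rw [← isIntegral_algEquiv (fractionEquiv F K)]
  set z := fractionEquiv F K q
  constructor
  -- Reducing a monic equation modulo nilpotents shows that the first coordinate is integral over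
  -- the integrally closed ring `F⟦X⟧`; conversely the second coordinate is nilpotent.
  · rintro ⟨p, hp, hpz⟩
    rw [← IsIntegrallyClosed.isIntegral_iff (R := F⟦X⟧)]
    let π : R F →+* F⟦X⟧ :=
      (TrivSqZeroExt.fstHom F⟦X⟧ F⟦X⟧ F⟦X⟧ : DualNumber F⟦X⟧ →+* F⟦X⟧).comp
        (dualEquiv F : R F →+* DualNumber F⟦X⟧)
    let ρ : DualNumber K →+* K :=
      (TrivSqZeroExt.fstHom K K K :
        DualNumber K →+* K)
    have hcomp : ρ.comp (algebraMap (R F) (DualNumber K)) =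
        (algebraMap F⟦X⟧ K).comp π := RingHom.ext fun r => fst_algebraMap r
    refine ⟨p.map π, hp.map π, ?_⟩
    have := congrArg ρ hpz
    rw [Polynomial.hom_eval₂, hcomp, map_zero] at this
    rw [Polynomial.eval₂_map]
    exact this
  · rintro ⟨a, ha⟩
    have hz : z = algebraMap (R F) _ (algebraMap F⟦X⟧ (R F) a) + TrivSqZeroExt.inr z.snd := by
      ext <;> simp [ha]
    rw [hz]
    refine isIntegral_algebraMap.add (IsIntegral.of_pow (n := 2) (by norm_num) ?_)
    have h0 : (TrivSqZeroExt.inr z.snd : DualNumber K) ^ 2 = 0 := by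
      rw [sq, TrivSqZeroExt.inr_mul_inr]
    exact h0.symm ▸ isIntegral_zero

lemma fractionEquiv_powerSeries_smul (a : F⟦X⟧) (q : Q F) :
    fractionEquiv F K (a • q) = a • fractionEquiv F K q := by
  rw [← algebraMap_smul (R F) a q, map_smul, Algebra.smul_def]
  refine TrivSqZeroExt.ext ?_ ?_
  · rw [TrivSqZeroExt.fst_mul, fst_algebraMap, dualEquiv_algebraMap, TrivSqZeroExt.fst_inl,
      TrivSqZeroExt.fst_smul, Algebra.smul_def]
  · rw [DualNumber.snd_mul, fst_algebraMap, snd_algebraMap, dualEquiv_algebraMap,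
      TrivSqZeroExt.fst_inl, TrivSqZeroExt.snd_inl, map_zero, zero_mul, add_zero,
      TrivSqZeroExt.snd_smul, Algebra.smul_def]

variable (F K) in
/-- The elements of the integral closure of `R` in `Q` are the `a + xq` with `a` a power series in
`y` and `q` in the fraction field; this is the map `(a, q) ↦ a + xq`. -/
noncomputable def ofCoord : F⟦X⟧ × K →ₗ[F⟦X⟧] Rtilde F where
  toFun c := ⟨(fractionEquiv F K).symm
    (TrivSqZeroExt.inl (algebraMap F⟦X⟧ K c.1) + TrivSqZeroExt.inr c.2),
    (isIntegral_iff K _).mpr ⟨c.1, by simp⟩⟩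
  map_add' c d := by
    apply Subtype.ext
    apply (fractionEquiv F K).injective
    ext <;> simp
  map_smul' a c := by
    apply Subtype.ext
    apply (fractionEquiv F K).injective
    change fractionEquiv F K ((fractionEquiv F K).symm _) = fractionEquiv F K (a • (_ : Q F))
    rw [fractionEquiv_powerSeries_smul, AlgEquiv.apply_symm_apply, AlgEquiv.apply_symm_apply,
      smul_add, ← TrivSqZeroExt.inl_smul, ← TrivSqZeroExt.inr_smul, Prod.smul_fst, Prod.smul_snd,
      smul_eq_mul, map_mul, ← Algebra.smul_def]

lemma fractionEquiv_ofCoord (c : F⟦X⟧ × K) :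
    fractionEquiv F K (ofCoord F K c : Q F) =
      TrivSqZeroExt.inl (algebraMap F⟦X⟧ K c.1) + TrivSqZeroExt.inr c.2 :=
  (fractionEquiv F K).apply_symm_apply _

variable (K) in
lemma ofCoord_bijective : Function.Bijective (ofCoord F K) := by
  constructor
  · intro c d h
    have h' := congrArg (fun r : Rtilde F => fractionEquiv F K (r : Q F)) h
    simp only [fractionEquiv_ofCoord] at h'
    ext1
    · apply IsFractionRing.injective F⟦X⟧ K
      simpa using congrArg TrivSqZeroExt.fst h'
    · simpa using congrArg TrivSqZeroExt.snd h'
  · intro r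
    obtain ⟨a, ha⟩ := (isIntegral_iff K (r : Q F)).mp r.2
    refine ⟨(a, (fractionEquiv F K r).snd), ?_⟩
    apply Subtype.ext
    apply (fractionEquiv F K).injective
    rw [fractionEquiv_ofCoord]
    ext <;> simp [ha]

variable (F K) in
/-- The coordinates `(a, q)` of an element `a + xq` of the integral closure. -/
noncomputable def coord : Rtilde F ≃ₗ[F⟦X⟧] F⟦X⟧ × K :=
  (LinearEquiv.ofBijective (ofCoord F K) (ofCoord_bijective K)).symm

lemma fractionEquiv_coe (r : Rtilde F) :
    fractionEquiv F K (r : Q F) =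
      TrivSqZeroExt.inl (algebraMap F⟦X⟧ K (coord F K r).1) +
        TrivSqZeroExt.inr (coord F K r).2 := by
  rw [← fractionEquiv_ofCoord]
  exact congrArg (fun s : Rtilde F => fractionEquiv F K (s : Q F))
    ((LinearEquiv.ofBijective (ofCoord F K) (ofCoord_bijective K)).apply_symm_apply r).symm

lemma coord_eq_iff (r : Rtilde F) (c : F⟦X⟧ × K) :
    coord F K r = c ↔ fractionEquiv F K (r : Q F) =
      TrivSqZeroExt.inl (algebraMap F⟦X⟧ K c.1) + TrivSqZeroExt.inr c.2 := by
  rw [← fractionEquiv_ofCoord, (fractionEquiv F K).injective.eq_iff, SetLike.coe_eq_coe]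
  exact (LinearEquiv.ofBijective (ofCoord F K) (ofCoord_bijective K)).symm_apply_eq

@[simp]
lemma coord_x_smul (r : Rtilde F) :
    coord F K (x F • r) = (0, algebraMap F⟦X⟧ K (coord F K r).1) := by
  rw [coord_eq_iff]
  change fractionEquiv F K (x F • (r : Q F)) = _
  rw [map_smul, Algebra.smul_def, fractionEquiv_coe]
  refine TrivSqZeroExt.ext ?_ ?_
  · simp only [TrivSqZeroExt.fst_mul, TrivSqZeroExt.fst_add, TrivSqZeroExt.fst_inl,
      TrivSqZeroExt.fst_inr, fst_algebraMap, dualEquiv_x, DualNumber.fst_eps, map_zero, zero_mul,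
      add_zero]
  · simp only [DualNumber.snd_mul, TrivSqZeroExt.fst_add, TrivSqZeroExt.snd_add,
      TrivSqZeroExt.fst_inl, TrivSqZeroExt.snd_inl, TrivSqZeroExt.fst_inr, TrivSqZeroExt.snd_inr,
      fst_algebraMap, snd_algebraMap, dualEquiv_x, DualNumber.fst_eps, DualNumber.snd_eps,
      map_zero, map_one, zero_mul, one_mul, add_zero, zero_add]

variable (F K) in
/-- The ideal `xR` is free of rank one over `F⟦y⟧`, with basis `x`. -/
noncomputable def iinfEquiv : F⟦X⟧ ≃ₗ[F⟦X⟧] Iinf F :=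
  LinearEquiv.ofBijective
    { toFun := fun a => ⟨x F * algebraMap F⟦X⟧ (R F) a,
        Ideal.mul_mem_right _ _ (Ideal.mem_span_singleton_self _)⟩
      map_add' := fun a b => Subtype.ext (by simp [mul_add])
      map_smul' := fun a b => Subtype.ext (by
        change x F * algebraMap F⟦X⟧ (R F) (a * b) = a • (x F * algebraMap F⟦X⟧ (R F) b)
        rw [Algebra.smul_def, map_mul, mul_left_comm]) } (by
    constructor
    · intro a b h
      have h' := congrArg (fun r : Iinf F => (dualEquiv F (r : R F)).snd) h
      simpa using h'
    · rintro ⟨r, hr⟩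
      obtain ⟨s, rfl⟩ := Ideal.mem_span_singleton'.mp hr
      refine ⟨(dualEquiv F s).fst, Subtype.ext ?_⟩
      apply (dualEquiv F).injective
      ext <;> simp)

lemma coe_iinfEquiv (a : F⟦X⟧) : (iinfEquiv F a : R F) = x F * algebraMap F⟦X⟧ (R F) a := rfl

@[simp]
lemma x_smul_iinf (w : Iinf F) : x F • w = 0 := by
  obtain ⟨a, rfl⟩ := (iinfEquiv F).surjective w
  apply Subtype.ext
  change x F * (x F * algebraMap F⟦X⟧ (R F) a) = 0
  rw [← mul_assoc, x_mul_x]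
  exact zero_mul _

variable (F K) in
lemma algebraMap_iinfEquiv_coord (r : Rtilde F) :
    algebraMap (R F) (Q F) (iinfEquiv F (coord F K r).1 : R F) =
      algebraMap (R F) (Q F) (x F) * (r : Q F) := by
  apply (fractionEquiv F K).injective
  rw [map_mul, fractionEquiv_coe, AlgEquiv.commutes, AlgEquiv.commutes, coe_iinfEquiv]
  ext <;> simp

end Coordinates

/-! ### Maps out of the integral closure -/

section AlmostSplit

variable {F : Type u} [Field F] {K : Type*} [Field K] [Algebra F⟦X⟧ K]

/-- Coordinates on an `R`-module `T` that make it isomorphic to the integral closure of `R`, whose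
elements are the `a + xq` with `a` in `F⟦y⟧` and `q` in its fraction field `K`. -/
structure Coordinates (F : Type u) [Field F] (K : Type*) [Field K] [Algebra F⟦X⟧ K] (T : Type*)
    [AddCommGroup T] [Module (R F) T] [Module F⟦X⟧ T] where
  /-- The underlying linear equivalence `a + xq ↦ (a, q)`. -/
  toLinearEquiv : T ≃ₗ[F⟦X⟧] F⟦X⟧ × K
  /-- Multiplication by `x` sends `a + xq` to `xa`. -/
  coord_x_smul : ∀ t, toLinearEquiv (x F • t) = (0, algebraMap F⟦X⟧ K (toLinearEquiv t).1)

variable {T : Type*} [AddCommGroup T] [Module (R F) T] [Module F⟦X⟧ T]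
variable {I : Type*} [AddCommGroup I] [Module (R F) I] [Module F⟦X⟧ I]
  [IsScalarTower F⟦X⟧ (R F) I]
variable {N : Type*} [AddCommGroup N] [Module (R F) N] [Module F⟦X⟧ N]
  [IsScalarTower F⟦X⟧ (R F) N]
variable (c : Coordinates F K T) (d : F⟦X⟧ ≃ₗ[F⟦X⟧] I)

namespace Coordinates

/-- The element `1` of the integral closure. -/
noncomputable def one : T := c.toLinearEquiv.symm (1, 0)

lemma coord_one : c.toLinearEquiv c.one = (1, 0) := c.toLinearEquiv.apply_symm_apply _

lemma x_smul_symm (a : F⟦X⟧) (q : K) :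
    x F • c.toLinearEquiv.symm (a, q) = c.toLinearEquiv.symm (0, algebraMap F⟦X⟧ K a) := by
  apply c.toLinearEquiv.injective
  rw [coord_x_smul, LinearEquiv.apply_symm_apply, LinearEquiv.apply_symm_apply]

lemma smul_x_smul_one (a : F⟦X⟧) :
    a • x F • c.one = c.toLinearEquiv.symm (0, algebraMap F⟦X⟧ K a) := by
  rw [one, x_smul_symm, ← map_smul, map_one, Prod.smul_mk, smul_zero,
    Algebra.algebraMap_eq_smul_one]

variable [IsScalarTower F⟦X⟧ (R F) T]

/-- The map `a + xq ↦ xa`, where `I` is free over `F⟦y⟧` on the element `x`. -/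
noncomputable def xHom (hI : ∀ w : I, x F • w = 0) : T →ₗ[R F] I :=
  linearOfCommute (d.toLinearMap ∘ₗ LinearMap.fst _ _ _ ∘ₗ c.toLinearEquiv.toLinearMap) fun t => by
    simp [coord_x_smul, hI]

lemma xHom_apply (hI : ∀ w : I, x F • w = 0) (t : T) :
    c.xHom d hI t = d (c.toLinearEquiv t).1 := rfl

variable [IsFractionRing F⟦X⟧ K]

/-- An `R`-linear map into the integral closure is a pair of `F⟦y⟧`-linear coordinate functions
`α` and `β`, subject to the relation `β (x • n) = α n`. -/
noncomputable def hom (α : N →ₗ[F⟦X⟧] F⟦X⟧) (β : N →ₗ[F⟦X⟧] K)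
    (h : ∀ n, β (x F • n) = algebraMap F⟦X⟧ K (α n)) : N →ₗ[R F] T :=
  linearOfCommute (c.toLinearEquiv.symm.toLinearMap ∘ₗ α.prod β) fun n => by
    have hα : α (x F • n) = 0 := by
      apply IsFractionRing.injective F⟦X⟧ K
      rw [← h, x_smul_x_smul, map_zero, map_zero]
    change c.toLinearEquiv.symm (α (x F • n), β (x F • n)) =
      x F • c.toLinearEquiv.symm (α n, β n)
    rw [hα, h, x_smul_symm]

lemma coord_hom (α : N →ₗ[F⟦X⟧] F⟦X⟧) (β : N →ₗ[F⟦X⟧] K)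
    (h : ∀ n, β (x F • n) = algebraMap F⟦X⟧ K (α n)) (n : N) :
    c.toLinearEquiv (c.hom α β h n) = (α n, β n) :=
  c.toLinearEquiv.apply_symm_apply _

lemma torsionFree (c : Coordinates F K T) (t : T) (h : y F • t = 0) : t = 0 := by
  have h' : (X : F⟦X⟧) • c.toLinearEquiv t = 0 := by
    rw [← map_smul, X_smul_eq, h, map_zero]
  have hX : algebraMap F⟦X⟧ K X ≠ 0 := by simp
  have h1 : X * (c.toLinearEquiv t).1 = 0 := congrArg Prod.fst h'
  have h2 : (X : F⟦X⟧) • (c.toLinearEquiv t).2 = 0 := congrArg Prod.snd h'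
  rw [Algebra.smul_def] at h2
  exact c.toLinearEquiv.map_eq_zero_iff.mp
    (Prod.ext ((mul_eq_zero.mp h1).resolve_left X_ne_zero) ((mul_eq_zero.mp h2).resolve_left hX))

end Coordinates

variable [IsScalarTower F⟦X⟧ (R F) T] [IsFractionRing F⟦X⟧ K]

/-- A map from the integral closure of `R` into a `y`-torsion-free module is determined by its
value at `1`. -/
lemma Coordinates.hom_ext (hN : ∀ n : N, y F • n = 0 → n = 0) {f g : T →ₗ[R F] N}
    (h : f c.one = g c.one) : f = g := by
  ext t
  obtain ⟨b, s, hs, hq⟩ := IsFractionRing.div_surjective (A := F⟦X⟧) (c.toLinearEquiv t).2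
  have hs0 : s ≠ 0 := nonZeroDivisors.ne_zero hs
  have ht : s • t = (s * (c.toLinearEquiv t).1) • c.one + b • x F • c.one := by
    apply c.toLinearEquiv.injective
    rw [smul_x_smul_one, map_add, map_smul, map_smul, coord_one, LinearEquiv.apply_symm_apply]
    ext1
    · simp
    · have : algebraMap F⟦X⟧ K s ≠ 0 := by simpa using hs0
      simp [← hq, Algebra.smul_def, mul_div_cancel₀ _ this]
  rw [← sub_eq_zero]
  refine powerSeries_smul_eq_zero hN hs0 _ ?_
  have hlin : ∀ k : T →ₗ[R F] N, s • k t =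
      (s * (c.toLinearEquiv t).1) • k c.one + b • x F • k c.one := by
    intro k
    rw [← LinearMap.map_smul_of_tower, ht, map_add, LinearMap.map_smul_of_tower,
      LinearMap.map_smul_of_tower, map_smul]
  rw [smul_sub, hlin, hlin, h, sub_self]

/-- The sequence is left almost split, first half: a map `h` factors through it as soon as
`x • h 1` is divisible by `y` in `x • N`. -/
lemma Coordinates.exists_factor_left (hI : ∀ w : I, x F • w = 0)
    (hN : ∀ n : N, y F • n = 0 → n = 0) (h : T →ₗ[R F] N) (n : N)
    (hn : x F • h c.one = y F • x F • n) :
    ∃ u : T × I →ₗ[R F] N, u ∘ₗ (LinearMap.prod (y F • LinearMap.id) (c.xHom d hI)) = h := by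
  have hX : algebraMap F⟦X⟧ K X ≠ 0 := by simp
  let hA : T →ₗ[F⟦X⟧] N := h.restrictScalars F⟦X⟧
  let e : T →ₗ[F⟦X⟧] F⟦X⟧ × K := c.toLinearEquiv.toLinearMap
  let e' : F⟦X⟧ × K →ₗ[F⟦X⟧] T := c.toLinearEquiv.symm.toLinearMap
  -- The map `a + xq ↦ a • n + h (x (q / y))`.
  let p₀ : T →ₗ[F⟦X⟧] N :=
    LinearMap.toSpanSingleton F⟦X⟧ N n ∘ₗ LinearMap.fst _ _ _ ∘ₗ e +
      hA ∘ₗ e' ∘ₗ LinearMap.inr _ _ _ ∘ₗ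
        LinearMap.mulLeft F⟦X⟧ (algebraMap F⟦X⟧ K X)⁻¹ ∘ₗ LinearMap.snd _ _ _ ∘ₗ e
  have hp₀ : ∀ t, p₀ t = (c.toLinearEquiv t).1 • n +
      h (c.toLinearEquiv.symm (0, (algebraMap F⟦X⟧ K X)⁻¹ * (c.toLinearEquiv t).2)) :=
    fun t => rfl
  let p : T →ₗ[R F] N := linearOfCommute p₀ fun t => by
    rw [hp₀, hp₀, coord_x_smul, smul_add, ← map_smul h, x_smul_symm, map_zero, zero_smul, zero_add,
      ← Prod.zero_eq_mk, map_zero, map_zero, add_zero, ← sub_eq_zero]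
    apply hN
    rw [smul_sub, sub_eq_zero, ← X_smul_eq (F := F), ← LinearMap.map_smul_of_tower, ← map_smul,
      Prod.smul_mk, smul_zero, Algebra.smul_def, mul_inv_cancel_left₀ hX, ← smul_x_smul_one,
      LinearMap.map_smul_of_tower, map_smul, hn, smul_comm (x F) _ n,
      smul_comm (y F) (c.toLinearEquiv t).1]
  let q : I →ₗ[R F] N :=
    linearOfCommute (LinearMap.toSpanSingleton F⟦X⟧ N (h c.one - y F • n) ∘ₗ d.symm.toLinearMap)
      fun w => by
        have h0 : x F • (h c.one - y F • n) = 0 := by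
          rw [smul_sub, hn, smul_comm, sub_self]
        simp [hI, smul_comm (x F), h0]
  refine ⟨p.coprod q, c.hom_ext hN ?_⟩
  have hp : p c.one = n := by
    change p₀ c.one = n
    rw [hp₀, coord_one, mul_zero, one_smul, ← Prod.zero_eq_mk, map_zero, map_zero, add_zero]
  have hq : q (c.xHom d hI c.one) = h c.one - y F • n := by
    change (d.symm (d (c.toLinearEquiv c.one).1)) • (h c.one - y F • n) = _
    rw [LinearEquiv.symm_apply_apply, coord_one, one_smul]
  change p (y F • c.one) + q (c.xHom d hI c.one) = _
  rw [map_smul, hp, hq, add_sub_cancel]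

/-- The sequence is left almost split, second half: a map `h` is a split monomorphism as soon as
`x • h 1` is not divisible by `y` in `x • N`. Then `x • h 1` spans a pure submodule of `x • N`, so
some `α : N → F⟦y⟧` kills the annihilator of `x` and sends `h 1` to `1`; it is the first coordinate
of a retraction. -/
lemma Coordinates.isSplitMono_of_not_dvd {T N : Type u} [AddCommGroup T] [Module (R F) T]
    [Module F⟦X⟧ T] [IsScalarTower F⟦X⟧ (R F) T] [AddCommGroup N] [Module (R F) N]
    [Module F⟦X⟧ N] [IsScalarTower F⟦X⟧ (R F) N] (c : Coordinates F K T)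
    (hN : ∀ n : N, y F • n = 0 → n = 0) (h : T →ₗ[R F] N)
    (hn : ∀ n : N, x F • h c.one ≠ y F • x F • n) : IsSplitMono h := by
  have hpow : ∀ (k : ℕ) (a : F⟦X⟧) (m : N),
      (X : F⟦X⟧) ^ k • x F • m = a • x F • h c.one → X ^ k ∣ a := by
    intro k
    induction k with
    | zero => simp
    | succ k ih =>
      intro a m hm
      have hXa : X ∣ a := by
        rw [X_dvd_iff]
        by_contra h0
        obtain ⟨b, hb⟩ := (isUnit_iff_constantCoeff.mpr (isUnit_iff_ne_zero.mpr h0)).exists_left_inv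
        refine hn (b • (X : F⟦X⟧) ^ k • m) ?_
        rw [← one_smul F⟦X⟧ (x F • h c.one), ← hb, mul_smul, ← hm, ← X_smul_eq (F := F), pow_succ',
          mul_smul, smul_comm (x F) b, smul_comm (x F), smul_comm b]
      obtain ⟨a, rfl⟩ := hXa
      rw [pow_succ']
      refine mul_dvd_mul_left X (ih a m ?_)
      rw [← sub_eq_zero]
      apply hN
      rw [← X_smul_eq (F := F), smul_sub, smul_smul, smul_smul, ← pow_succ', hm, sub_self]
  -- `α` is prescribed on the span of `h 1` and the annihilator of `x`.
  obtain ⟨α, hα⟩ := exists_extension_powerSeries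
    ((LinearMap.toSpanSingleton F⟦X⟧ N (h c.one)).coprod (LinearMap.ker (xMul F N)).subtype)
    (LinearMap.fst _ _ _) (by
      rintro k ⟨a, z⟩ m hm
      refine hpow k a m ?_
      have hz : x F • (z : N) = 0 := z.2
      have hm' : (X : F⟦X⟧) ^ k • m = a • h c.one + z := hm
      rw [smul_comm, hm', smul_add, hz, add_zero, smul_comm])
  have hα1 : α (h c.one) = 1 := by simpa using hα (1, 0)
  have hαz : ∀ z : N, x F • z = 0 → α z = 0 := fun z hz => by simpa using hα (0, ⟨z, hz⟩)
  -- `β` has to satisfy `β (x • m) = α m`; the normalization `β (h 1) = 0` makes the resulting map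
  -- send `h 1` to `1` exactly, and not only up to an automorphism.
  obtain ⟨β, hβ⟩ := exists_extension_fractionRing (K := K)
    ((LinearMap.toSpanSingleton F⟦X⟧ N (h c.one)).coprod (xMul F N))
    (Algebra.linearMap F⟦X⟧ K ∘ₗ α ∘ₗ LinearMap.snd _ _ _) (by
      rintro ⟨a, m⟩ hm
      have hm' : a • h c.one + x F • m = 0 := hm
      have ha : a = 0 := by
        have : α (a • h c.one) = 0 := hαz _ (by
          rw [eq_neg_of_add_eq_zero_left hm', smul_neg, x_smul_x_smul, neg_zero])
        rwa [map_smul, hα1, smul_eq_mul, mul_one] at this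
      rw [ha, zero_smul, zero_add] at hm'
      simp [hαz m hm'])
  have hβ1 : β (h c.one) = 0 := by simpa using hβ (1, 0)
  have hβx : ∀ m, β (x F • m) = algebraMap F⟦X⟧ K (α m) := fun m => by simpa using hβ (0, m)
  refine ⟨c.hom α β hβx, c.hom_ext c.torsionFree ?_⟩
  apply c.toLinearEquiv.injective
  change c.toLinearEquiv (c.hom α β hβx (h c.one)) = c.toLinearEquiv c.one
  rw [coord_hom, hα1, hβ1, coord_one]

end AlmostSplit

/-! ### Maps into the ideal `xR` -/

section RightAlmostSplit

variable {F : Type u} [Field F] {K : Type*} [Field K] [Algebra F⟦X⟧ K] [IsFractionRing F⟦X⟧ K]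
variable {T : Type*} [AddCommGroup T] [Module (R F) T] [Module F⟦X⟧ T]
  [IsScalarTower F⟦X⟧ (R F) T]
variable {N I : Type u} [AddCommGroup I] [Module (R F) I] [Module F⟦X⟧ I]
  [IsScalarTower F⟦X⟧ (R F) I]
variable [AddCommGroup N] [Module (R F) N] [Module F⟦X⟧ N] [IsScalarTower F⟦X⟧ (R F) N]

lemma torsionFree_of_powerSeries_equiv (d : F⟦X⟧ ≃ₗ[F⟦X⟧] I) (w : I) (h : y F • w = 0) :
    w = 0 := by
  have h' : X * d.symm w = 0 := by
    rw [← smul_eq_mul, ← map_smul, X_smul_eq, h, map_zero]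
  exact d.symm.map_eq_zero_iff.mp ((mul_eq_zero.mp h').resolve_left X_ne_zero)

/-- The sequence is right almost split, first half: a map `h` to `I ≅ F⟦y⟧` factors through it as
soon as it maps the annihilator of `x` into `yI`. Then `-h / y` on the annihilator of `x` extends
to some `σ : N → F⟦y⟧` that kills `x • N`, and `h + yσ` kills the annihilator of `x`, so it is the
first coordinate of a map to the integral closure. -/
lemma Coordinates.exists_factor_right (c : Coordinates F K T) (d : F⟦X⟧ ≃ₗ[F⟦X⟧] I)
    (hI : ∀ w : I, x F • w = 0) (hN : ∀ n : N, y F • n = 0 → n = 0) (h : N →ₗ[R F] I)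
    (hdvd : ∀ n, x F • n = 0 → X ∣ d.symm (h n)) :
    ∃ u : N →ₗ[R F] T × I,
      (LinearMap.coprod (c.xHom d hI) (-(y F • LinearMap.id))) ∘ₗ u = h := by
  let η : N →ₗ[F⟦X⟧] F⟦X⟧ := d.symm.toLinearMap ∘ₗ h.restrictScalars F⟦X⟧
  have hη : ∀ n, η (x F • n) = 0 := fun n => by
    change d.symm (h (x F • n)) = 0
    rw [map_smul, hI, map_zero]
  choose θ₀ hθ₀ using fun z : LinearMap.ker (xMul F N) => hdvd z z.2
  let θ : LinearMap.ker (xMul F N) →ₗ[F⟦X⟧] F⟦X⟧ :=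
    { toFun := θ₀
      map_add' := fun z w => mul_left_cancel₀ X_ne_zero (by
        rw [← hθ₀, mul_add, ← hθ₀, ← hθ₀]
        exact map_add η _ _)
      map_smul' := fun a z => mul_left_cancel₀ X_ne_zero (by
        rw [← hθ₀, RingHom.id_apply, smul_eq_mul, mul_left_comm, ← hθ₀]
        exact map_smul η _ _) }
  have hθ : ∀ z : LinearMap.ker (xMul F N), η z = X * θ z := hθ₀
  obtain ⟨σ, hσ⟩ := exists_extension_powerSeries
    ((LinearMap.ker (xMul F N)).subtype.coprod (xMul F N)) (-θ ∘ₗ LinearMap.fst _ _ _) (by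
      rintro k ⟨z, n⟩ m hm
      have hm' : (X : F⟦X⟧) ^ k • m = z + x F • n := hm
      have hz : x F • (z : N) = 0 := z.2
      have hmx : x F • m = 0 := X_pow_smul_eq_zero hN k _ (by
        rw [smul_comm, hm', smul_add, hz, x_smul_x_smul, add_zero])
      have hk : θ z = X ^ k * θ ⟨m, hmx⟩ := by
        refine mul_left_cancel₀ X_ne_zero ?_
        rw [← hθ, mul_left_comm, ← hθ, ← smul_eq_mul, ← map_smul, hm', map_add, hη, add_zero]
      simp [hk])
  have hσz : ∀ z, x F • z = 0 → η z + X * σ z = 0 := fun z hz => by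
    have h1 : σ z = -θ ⟨z, hz⟩ := by simpa using hσ (⟨z, hz⟩, 0)
    rw [hθ ⟨z, hz⟩, h1, mul_neg, add_neg_cancel]
  have hσx : ∀ n, σ (x F • n) = 0 := fun n => by simpa using hσ (0, n)
  obtain ⟨β, hβ⟩ := exists_extension_fractionRing (K := K) (xMul F N)
    (Algebra.linearMap F⟦X⟧ K ∘ₗ (η + (X : F⟦X⟧) • σ)) (fun n hn => by
      have := hσz n hn
      simp only [LinearMap.comp_apply, LinearMap.add_apply, LinearMap.smul_apply, smul_eq_mul]
      rw [this, map_zero])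
  have hβx : ∀ n, β (x F • n) = algebraMap F⟦X⟧ K ((η + (X : F⟦X⟧) • σ) n) := hβ
  let s : N →ₗ[R F] I := linearOfCommute (d.toLinearMap ∘ₗ σ) fun n => by simp [hσx, hI]
  refine ⟨(c.hom (η + (X : F⟦X⟧) • σ) β hβx).prod s, LinearMap.ext fun n => ?_⟩
  have hs : s n = d (σ n) := rfl
  have hηn : d (η n) = h n := d.apply_symm_apply _
  change c.xHom d hI (c.hom (η + (X : F⟦X⟧) • σ) β hβx n) + -(y F • s n) = h n
  rw [c.xHom_apply, c.coord_hom, hs, ← X_smul_eq (F := F) (d (σ n)), ← map_smul, ← hηn,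
    ← sub_eq_add_neg, ← map_sub, LinearMap.add_apply, LinearMap.smul_apply, add_sub_cancel_right]

/-- The sequence is right almost split, second half: a map `h` to `I ≅ F⟦y⟧` is a split epimorphism
as soon as it maps an element killed by `x` to a generator. -/
lemma isSplitEpi_of_not_dvd (d : F⟦X⟧ ≃ₗ[F⟦X⟧] I) (hI : ∀ w : I, x F • w = 0) (h : N →ₗ[R F] I)
    (n : N) (hn : x F • n = 0) (hdvd : ¬ X ∣ d.symm (h n)) : IsSplitEpi h := by
  rw [X_dvd_iff] at hdvd
  obtain ⟨b, hb⟩ :=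
    (isUnit_iff_constantCoeff.mpr (isUnit_iff_ne_zero.mpr hdvd)).exists_left_inv
  refine ⟨linearOfCommute (LinearMap.toSpanSingleton F⟦X⟧ N (b • n) ∘ₗ d.symm.toLinearMap)
    fun w => ?_, LinearMap.ext fun w => ?_⟩
  · simp [hI, smul_comm (x F), hn]
  · change h (d.symm w • b • n) = w
    apply d.symm.injective
    rw [LinearMap.map_smul_of_tower, LinearMap.map_smul_of_tower, map_smul, map_smul, smul_eq_mul,
      smul_eq_mul, hb, mul_one]

end RightAlmostSplit

/-! ### The almost split sequence -/

section AlmostSplitSequence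

variable {F : Type u} [Field F] {K : Type*} [Field K] [Algebra F⟦X⟧ K] [IsFractionRing F⟦X⟧ K]
lemma Coordinates.fst_eq_zero_of_x_smul {T : Type*} [AddCommGroup T]
    [Module (R F) T] [Module F⟦X⟧ T] (c : Coordinates F K T) {t : T} (ht : x F • t = 0) :
    (c.toLinearEquiv t).1 = 0 := by
  apply IsFractionRing.injective F⟦X⟧ K
  rw [map_zero]
  have := congrArg Prod.snd (c.coord_x_smul t)
  rw [ht, map_zero] at this
  exact this.symm

variable {T I : Type u} [AddCommGroup T] [Module (R F) T] [Module F⟦X⟧ T]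
  [IsScalarTower F⟦X⟧ (R F) T]
variable [AddCommGroup I] [Module (R F) I] [Module F⟦X⟧ I] [IsScalarTower F⟦X⟧ (R F) I]

/-- Every `R`-module is an `F⟦X⟧`-module, where `X` acts as `y`. -/
noncomputable abbrev powerSeriesModule (N : Type*) [AddCommGroup N] [Module (R F) N] :
    Module F⟦X⟧ N :=
  Module.compHom N (algebraMap F⟦X⟧ (R F))

/-- The almost split sequence in coordinates. -/
theorem Coordinates.isAlmostSplitSequence (c : Coordinates F K T) (d : F⟦X⟧ ≃ₗ[F⟦X⟧] I)
    (hI : ∀ w : I, x F • w = 0) :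
    IsAlmostSplitSequence
      (LinearMap.prod (y F • LinearMap.id) (c.xHom d hI) : T →ₗ[R F] T × I)
      (LinearMap.coprod (c.xHom d hI) (-(y F • LinearMap.id)) : T × I →ₗ[R F] I) where
  cm_left := isCM_iff.mpr c.torsionFree
  cm_middle := isCM_iff.mpr fun p hp => Prod.ext (c.torsionFree _ (congrArg Prod.fst hp))
    (torsionFree_of_powerSeries_equiv d _ (congrArg Prod.snd hp))
  cm_right := isCM_iff.mpr (torsionFree_of_powerSeries_equiv d)
  injective := by
    rw [injective_iff_map_eq_zero]
    exact fun t ht => c.torsionFree t (congrArg Prod.fst ht)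
  exact := by
    rintro ⟨t, w⟩
    constructor
    · intro h
      obtain ⟨b, rfl⟩ := d.surjective w
      have h' : c.xHom d hI t + -(y F • d b) = 0 := h
      have hX : algebraMap F⟦X⟧ K X ≠ 0 := by simp
      rw [c.xHom_apply, ← X_smul_eq (F := F) (d b), ← map_smul, ← sub_eq_add_neg, sub_eq_zero,
        d.injective.eq_iff] at h'
      refine ⟨c.toLinearEquiv.symm
        (b, (algebraMap F⟦X⟧ K X)⁻¹ * (c.toLinearEquiv t).2), Prod.ext ?_ ?_⟩
      · change y F • c.toLinearEquiv.symm _ = t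
        rw [← X_smul_eq (F := F), ← map_smul, LinearEquiv.symm_apply_eq, Prod.smul_mk,
          Algebra.smul_def X (_ * _), mul_inv_cancel_left₀ hX, ← h']
      · change c.xHom d hI (c.toLinearEquiv.symm _) = d b
        rw [c.xHom_apply, LinearEquiv.apply_symm_apply]
    · rintro ⟨s, hs⟩
      rw [← hs]
      change c.xHom d hI (y F • s) + -(y F • c.xHom d hI s) = 0
      rw [map_smul, add_neg_cancel]
  surjective := by
    intro w
    refine ⟨(c.toLinearEquiv.symm (d.symm w, 0), 0), ?_⟩
    change c.xHom d hI (c.toLinearEquiv.symm _) + -(y F • (0 : I)) = w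
    rw [c.xHom_apply, LinearEquiv.apply_symm_apply, LinearEquiv.apply_symm_apply, smul_zero,
      neg_zero, add_zero]
  left_almost_split := by
    refine ⟨?_, ?_⟩
    -- A retraction would write `1` as the sum of a multiple of `y` and an element killed by `x`.
    · rintro ⟨r, hr⟩
      have h1 : r (y F • c.one, c.xHom d hI c.one) = c.one := LinearMap.congr_fun hr c.one
      have h2 : (y F • c.one, c.xHom d hI c.one) =
          y F • ((c.one, 0) : T × I) + (0, c.xHom d hI c.one) := by simp
      have h3 : (c.toLinearEquiv (r (0, c.xHom d hI c.one))).1 = 0 := by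
        apply c.fst_eq_zero_of_x_smul
        rw [← map_smul, Prod.smul_mk, hI, smul_zero, ← Prod.zero_eq_mk, map_zero]
      rw [h2, map_add, map_smul, ← X_smul_eq (F := F)] at h1
      have h4 := congrArg (fun t => (c.toLinearEquiv t).1) h1
      simp only [map_add, map_smul, Prod.fst_add, Prod.smul_fst, h3, add_zero, c.coord_one,
        smul_eq_mul] at h4
      exact X_prime.not_isUnit (IsUnit.of_mul_eq_one _ h4)
    · intro N _ _ hN h hh
      let _ : Module F⟦X⟧ N := powerSeriesModule (F := F) N
      have : IsScalarTower F⟦X⟧ (R F) N := IsScalarTower.of_algebraMap_smul fun _ _ => rfl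
      rw [isCM_iff] at hN
      by_cases hn : ∃ n : N, x F • h c.one = y F • x F • n
      · obtain ⟨n, hn⟩ := hn
        exact c.exists_factor_left d hI hN h n hn
      · exact absurd (c.isSplitMono_of_not_dvd hN h (not_exists.mp hn)) hh
  right_almost_split := by
    refine ⟨?_, ?_⟩
    -- A section would make the generator `x` of `I` a multiple of `y`.
    · rintro ⟨s, hs⟩
      have h1 : c.xHom d hI (s (d 1)).1 + -(y F • (s (d 1)).2) = d 1 := LinearMap.congr_fun hs (d 1)
      have h2 : (c.toLinearEquiv (s (d 1)).1).1 = 0 := by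
        apply c.fst_eq_zero_of_x_smul
        rw [← Prod.smul_fst, ← map_smul, hI, map_zero, Prod.fst_zero]
      rw [c.xHom_apply, h2, map_zero, zero_add, ← X_smul_eq (F := F), ← smul_neg] at h1
      have h4 := congrArg d.symm h1
      rw [map_smul, LinearEquiv.symm_apply_apply, smul_eq_mul] at h4
      exact X_prime.not_isUnit (IsUnit.of_mul_eq_one _ h4)
    · intro N _ _ hN h hh
      let _ : Module F⟦X⟧ N := powerSeriesModule (F := F) N
      have : IsScalarTower F⟦X⟧ (R F) N := IsScalarTower.of_algebraMap_smul fun _ _ => rfl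
      rw [isCM_iff] at hN
      refine c.exists_factor_right d hI hN h fun n hn => ?_
      by_contra hdvd
      exact hh (isSplitEpi_of_not_dvd d hI h n hn hdvd)

end AlmostSplitSequence

/-! ### Pure injectivity and infinite generation -/

section PureInjective

variable {F : Type u} [Field F] {K : Type*} [Field K] [Algebra F⟦X⟧ K] [IsFractionRing F⟦X⟧ K]

lemma IsPureMono.exists_smul_eq {S A B : Type u} [CommRing S] [AddCommGroup A] [Module S A]
    [AddCommGroup B] [Module S B] {i : A →ₗ[S] B} (hi : IsPureMono i) (r : S) (b : B) (m : A)
    (h : r • b = i m) : ∃ v : A, r • v = m := by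
  obtain ⟨v, hv⟩ := hi.2 1 1 (fun _ _ => r) (fun _ => m) ⟨fun _ => b, by simpa using h⟩
  exact ⟨v 0, by simpa using hv 0⟩

/-- The integral closure is pure injective: both coordinates of a map into it extend along a pure
monomorphism, the first one to a function that kills the annihilator of `x`. Only the purity of
single equations `r • v = m` matters. -/
theorem Coordinates.isPureInjective {T : Type u} [AddCommGroup T] [Module (R F) T]
    [Module F⟦X⟧ T] [IsScalarTower F⟦X⟧ (R F) T] (c : Coordinates F K T) :
    IsPureInjective (R F) T := by
  intro A B _ _ _ _ i hi f
  let _ : Module F⟦X⟧ A := powerSeriesModule (F := F) A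
  have : IsScalarTower F⟦X⟧ (R F) A := IsScalarTower.of_algebraMap_smul fun _ _ => rfl
  let _ : Module F⟦X⟧ B := powerSeriesModule (F := F) B
  have : IsScalarTower F⟦X⟧ (R F) B := IsScalarTower.of_algebraMap_smul fun _ _ => rfl
  let iX : A →ₗ[F⟦X⟧] B := i.restrictScalars F⟦X⟧
  let fX : A →ₗ[F⟦X⟧] F⟦X⟧ × K := c.toLinearEquiv.toLinearMap ∘ₗ f.restrictScalars F⟦X⟧
  let α : A →ₗ[F⟦X⟧] F⟦X⟧ := LinearMap.fst _ _ _ ∘ₗ fX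
  let β : A →ₗ[F⟦X⟧] K := LinearMap.snd _ _ _ ∘ₗ fX
  have hf : ∀ a, c.toLinearEquiv (f a) = (α a, β a) := fun a => rfl
  have hβx : ∀ a, β (x F • a) = algebraMap F⟦X⟧ K (α a) := fun a => by
    have := hf (x F • a)
    rw [map_smul, c.coord_x_smul] at this
    exact (congrArg Prod.snd this).symm
  have hαz : ∀ a, x F • a = 0 → α a = 0 := fun a ha => by
    apply IsFractionRing.injective F⟦X⟧ K
    rw [← hβx, ha, map_zero, map_zero]
  obtain ⟨α', hα'⟩ := exists_extension_powerSeries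
    (iX.coprod (LinearMap.ker (xMul F B)).subtype) (α ∘ₗ LinearMap.fst _ _ _) (by
      rintro k ⟨a, z⟩ b hb
      have hb' : (X : F⟦X⟧) ^ k • b = i a + z := hb
      have hz : x F • (z : B) = 0 := z.2
      obtain ⟨v, hv⟩ := hi.exists_smul_eq (x F * algebraMap F⟦X⟧ (R F) (X ^ k)) b (x F • a) (by
        rw [mul_smul, algebraMap_smul, hb', smul_add, hz, add_zero, map_smul])
      refine ⟨α v, ?_⟩
      change α a = X ^ k * α v
      rw [← sub_eq_zero, ← smul_eq_mul, ← map_smul, ← map_sub]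
      apply hαz
      rw [smul_sub, ← hv, mul_smul, algebraMap_smul, sub_self])
  have hα'i : ∀ a, α' (i a) = α a := fun a => by simpa [iX] using hα' (a, 0)
  have hα'z : ∀ z, x F • z = 0 → α' z = 0 := fun z hz => by simpa using hα' (0, ⟨z, hz⟩)
  obtain ⟨β', hβ'⟩ := exists_extension_fractionRing (K := K) (iX.coprod (xMul F B))
    (β.coprod (Algebra.linearMap F⟦X⟧ K ∘ₗ α')) (by
      rintro ⟨a, b⟩ hab
      have hab' : i a + x F • b = 0 := hab
      obtain ⟨v, rfl⟩ := hi.exists_smul_eq (x F) (-b) a (by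
        rw [smul_neg, eq_neg_of_add_eq_zero_left hab'])
      have hb : α' (i v + b) = 0 := hα'z _ (by rw [smul_add, ← map_smul, hab'])
      rw [map_add, hα'i] at hb
      simp [hβx, ← map_add, hb])
  have hβ'i : ∀ a, β' (i a) = β a := fun a => by simpa [iX] using hβ' (a, 0)
  have hβ'x : ∀ b, β' (x F • b) = algebraMap F⟦X⟧ K (α' b) := fun b => by simpa using hβ' (0, b)
  refine ⟨c.hom α' β' hβ'x, LinearMap.ext fun a => c.toLinearEquiv.injective ?_⟩
  rw [LinearMap.comp_apply, c.coord_hom, hα'i, hβ'i, hf]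

/-- `R` is finite over `F⟦y⟧`, and the fraction field of `F⟦y⟧` is not. -/
theorem Coordinates.not_finite {T : Type*} [AddCommGroup T] [Module (R F) T] [Module F⟦X⟧ T]
    [IsScalarTower F⟦X⟧ (R F) T] (c : Coordinates F K T) : ¬ Module.Finite (R F) T := by
  intro _
  have : Module.Finite F⟦X⟧ (R F) := by
    refine Module.Finite.of_surjective ((LinearMap.toSpanSingleton F⟦X⟧ (R F) 1).coprod
      (LinearMap.toSpanSingleton F⟦X⟧ (R F) (x F))) fun r =>
        ⟨((dualEquiv F r).fst, (dualEquiv F r).snd), ?_⟩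
    conv_rhs => rw [eq_algebraMap_add r]
    simp [Algebra.smul_def, mul_comm]
  have : Module.Finite F⟦X⟧ T := Module.Finite.trans (R F) T
  have : Module.Finite F⟦X⟧ K := Module.Finite.of_surjective
    (LinearMap.snd F⟦X⟧ F⟦X⟧ K ∘ₗ c.toLinearEquiv.toLinearMap)
    (Prod.snd_surjective.comp c.toLinearEquiv.surjective)
  exact IsDiscreteValuationRing.not_isField F⟦X⟧
    (isField_of_isIntegral_of_isField (IsFractionRing.injective F⟦X⟧ K) (Field.toIsField K))

end PureInjective

/-! ### The integral closure of `R` in `Q` -/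

section Closure

variable (F : Type u) [Field F]

/-- The coordinates of the integral closure of `R` in `Q`. -/
noncomputable def rtildeCoordinates : Coordinates F (FractionRing F⟦X⟧) (Rtilde F) where
  toLinearEquiv := coord F _
  coord_x_smul := coord_x_smul

end Closure

end AInfty

open AInfty in
theorem proposition7p2 (F : Type u) [Field F] [IsAlgClosed F] (hF : ringChar F ≠ 2) :
    (∃ xmap : Rtilde F →ₗ[R F] Iinf F,
      (∀ r : Rtilde F, algebraMap (R F) (Q F) (xmap r : R F) =
        algebraMap (R F) (Q F) (x F) * (r : Q F)) ∧
      IsAlmostSplitSequence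
        (LinearMap.prod (y F • LinearMap.id) xmap :
          Rtilde F →ₗ[R F] Rtilde F × Iinf F)
        (LinearMap.coprod xmap (-(y F • LinearMap.id)) :
          Rtilde F × Iinf F →ₗ[R F] Iinf F)) ∧
    ¬ Module.Finite (R F) (Rtilde F) ∧
    IsPureInjective (R F) (Rtilde F) := by
  refine ⟨⟨(rtildeCoordinates F).xHom (iinfEquiv F) x_smul_iinf, fun r => ?_,
    (rtildeCoordinates F).isAlmostSplitSequence (iinfEquiv F) x_smul_iinf⟩,
    (rtildeCoordinates F).not_finite, (rtildeCoordinates F).isPureInjective⟩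
  rw [Coordinates.xHom_apply]
  exact algebraMap_iinfEquiv_coord F (FractionRing _) r
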